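/- Let $(R,\mathfrak m)$ be a one-dimensional Noetherian local domain with infinite residue field $k$ and fraction field $K$. Assume that the integral closure $\overline R$ of $R$ in $K$ is a finite $R$-module and a discrete valuation ring (i.e. $R$ is analytically irreducible), and that $R$ is residually rational, i.e. the natural map from $k$ to the residue field of $\overline R$ is an isomorphism. For fractional ideals $F,G$ of $R$ put $F:G=\{x\in K \mid xG\subseteq F\}$. Let $$\Lambda=\bigcup_{n\ge 0}(\mathfrak m^n:\mathfrak m^n)$$ be the blowing-up of $R$ along $\mathfrak m$, and suppose that $\mathfrak m$ is stable, i.e. $\Lambda=\mathfrak m:\mathfrak m$. Then the following are equivalent: 1. $R$ is almost Gorenstein, i.e. $\mathfrak m=\mathfrak m\,\omega$, where $\omega$ is a canonical ideal of $R$ with $R\subseteq\omega\subseteq\overline R$ (a canonical ideal is a nonzero fractional ideal $\omega$ with $\omega:(\omega:J)=J$ for every nonzero fractional ideal $J$ of $R$; a canonical ideal with $R\subseteq\omega\subseteq\overline R$ exists, and the condition $\mathfrak m=\mathfrak m\,\omega$ does not depend on its choice); 2. $\Lambda$ is Gorenstein, i.e. a Noetherian local ring of finite injective dimension over itself. -/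

import Mathlib

open IsLocalRing
open scoped nonZeroDivisors

/-- A Gorenstein local ring: a Noetherian local ring of finite injective dimension as a module
over itself. -/
def IsGorensteinLocalRing (A : Type*) [CommRing A] : Prop :=
  IsNoetherianRing A ∧ IsLocalRing A ∧
    ∃ n : ℕ, CategoryTheory.HasInjectiveDimensionLE (ModuleCat.of A A) n

section

variable (R : Type*) [CommRing R] (K : Type*) [Field K] [Algebra R K]

/-- `x ∈ A : A` implies `x ∈ AB : AB`. -/
theorem mem_div_self_mul {A : Submodule R K} (B : Submodule R K) {x : K} (hx : x ∈ A / A) :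
    x ∈ (A * B) / (A * B) := by
  rw [Submodule.mem_div_iff_forall_mul_mem] at hx ⊢
  intro y hy
  induction hy using Submodule.mul_induction_on' with
  | mem_mul_mem a ha b hb => rw [← mul_assoc]; exact Submodule.mul_mem_mul (hx a ha) hb
  | add y _ z _ hy hz => rw [mul_add]; exact add_mem hy hz

/-- The blowing-up `Λ(I) = ⋃ₙ (Iⁿ : Iⁿ)` of `R` along `I`, where the colon is taken in `K`
(`F / G = {x : K | x G ⊆ F}` for submodules `F`, `G` of `K`). -/
def blowUp (I : Ideal R) : Subalgebra R K where
  carrier := {x | ∃ n : ℕ,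
    x ∈ IsLocalization.coeSubmodule K I ^ n / IsLocalization.coeSubmodule K I ^ n}
  mul_mem' := by
    rintro x y ⟨n, hx⟩ ⟨m, hy⟩
    refine ⟨n + m, ?_⟩
    have hx' := mem_div_self_mul R K (IsLocalization.coeSubmodule K I ^ m) hx
    have hy' := mem_div_self_mul R K (IsLocalization.coeSubmodule K I ^ n) hy
    rw [← pow_add] at hx' hy'
    rw [add_comm m n] at hy'
    rw [Submodule.mem_div_iff_forall_mul_mem] at hx' hy' ⊢
    intro z hz
    rw [mul_assoc]
    exact hx' _ (hy' z hz)
  add_mem' := by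
    rintro x y ⟨n, hx⟩ ⟨m, hy⟩
    refine ⟨n + m, ?_⟩
    have hx' := mem_div_self_mul R K (IsLocalization.coeSubmodule K I ^ m) hx
    have hy' := mem_div_self_mul R K (IsLocalization.coeSubmodule K I ^ n) hy
    rw [← pow_add] at hx' hy'
    rw [add_comm m n] at hy'
    exact add_mem hx' hy'
  algebraMap_mem' := fun r => ⟨0, by
    rw [Submodule.mem_div_iff_forall_mul_mem]
    intro y hy
    rw [← Algebra.smul_def]
    exact Submodule.smul_mem _ r hy⟩

/-- The maximal ideal `𝔪` of a local ring is stable if `Λ(𝔪) = 𝔪 : 𝔪`. -/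
def IsStableMaximalIdeal [IsLocalRing R] : Prop :=
  Subalgebra.toSubmodule (blowUp R K (maximalIdeal R)) =
    IsLocalization.coeSubmodule K (maximalIdeal R) /
      IsLocalization.coeSubmodule K (maximalIdeal R)

variable {R K} in
/-- A canonical (fractional) ideal of a one-dimensional Noetherian local domain `R` with fraction
field `K`: a nonzero fractional ideal `ω` such that `ω : (ω : J) = J` for every nonzero
fractional ideal `J`. -/
def IsCanonicalIdeal [IsDomain R] [IsFractionRing R K] (ω : FractionalIdeal R⁰ K) : Prop :=
  ω ≠ 0 ∧ ∀ J : FractionalIdeal R⁰ K, J ≠ 0 → ω / (ω / J) = J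

/-- `R` is almost Gorenstein if `𝔪 = 𝔪 ω`, where `ω` is a canonical ideal normalized by
`R ⊆ ω ⊆ R̄`, with `R̄` the integral closure of `R` in `K`.  (Two such `ω` differ by a unit of
`R̄`, so that the condition does not depend on the choice.) -/
def IsAlmostGorenstein [IsDomain R] [IsLocalRing R] [IsFractionRing R K] : Prop :=
  ∃ ω : FractionalIdeal R⁰ K, IsCanonicalIdeal ω ∧ 1 ≤ ω ∧
    (ω : Submodule R K) ≤ Subalgebra.toSubmodule (integralClosure R K) ∧
    (maximalIdeal R : FractionalIdeal R⁰ K) = (maximalIdeal R : FractionalIdeal R⁰ K) * ω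

end

/-!
Stability together with `R̄` being a discrete valuation ring gives `𝔪 = xΛ` for some `x ≠ 0`, so
that `𝔪 = 𝔪ω` for `R ⊆ ω` just says `ω ⊆ Λ`, and `R` is almost Gorenstein if and only if some
canonical ideal `ω` satisfies `R ⊆ ω ⊆ Λ`. In dimension one, a local domain `A` with fraction field
`K` is Gorenstein if and only if `K / A` is injective, because divisible modules of finite injective
dimension are injective; and `K / A` is injective if and only if `A : (A : J) = J` for all nonzero
fractional ideals `J`.

If `R ⊆ ω ⊆ Λ` is canonical, then `ω : Λ` is a multiple of `Λ` (it is `𝔪 = xΛ` when `ω ≠ Λ`), so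
the `ω`-duality on `Λ`-modules is the `Λ`-duality. Conversely, let `Λ ≠ R` be Gorenstein with
maximal ideal `𝔫`. Choose a maximal proper `R`-submodule `W` of `Λ` which contains `R` but not a
given element of `x(Λ : 𝔫) ∖ R`. Then `W : Λ = xΛ` and `W : 𝔪 = Λ` covers `W`. The former gives
`W`-duality for the `Λ`-module `𝔪J`, and the latter propagates it to `J` one generator at a time.
-/

open scoped Pointwise
open IsLocalization (coeSubmodule)

section Colon

variable {R K : Type*} [CommRing R] [Field K] [Algebra R K] {I J N ω : Submodule R K} {c : K}

theorem fg_one : (1 : Submodule R K).FG := by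
  rw [Submodule.one_eq_span]
  exact Submodule.fg_span_singleton 1

theorem fg_smul {c : K} {N : Submodule R K} (hN : N.FG) : (c • N).FG :=
  hN.map _

theorem colon_mul_le : I / J * J ≤ I :=
  Submodule.le_div_iff_mul_le.mp le_rfl

theorem le_colon_colon : J ≤ I / (I / J) := by
  rw [Submodule.le_div_iff_mul_le, mul_comm]
  exact colon_mul_le

theorem colon_anti (h : J ≤ N) : I / N ≤ I / J :=
  Submodule.le_div_iff_mul_le.mpr ((mul_le_mul_right h _).trans colon_mul_le)

theorem colon_mul : I / (N * J) = I / N / J :=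
  eq_of_forall_le_iff fun P ↦ by
    simp only [Submodule.le_div_iff_mul_le, mul_assoc, mul_comm J N]

theorem colon_one : I / 1 = I :=
  eq_of_forall_le_iff fun P ↦ by rw [Submodule.le_div_iff_mul_le, mul_one]

theorem mul_colon_le_colon (h : I * N ≤ N) : I * (N / J) ≤ N / J := by
  rw [Submodule.le_div_iff_mul_le, mul_assoc]
  exact (mul_le_mul_right colon_mul_le I).trans h

theorem mem_smul_iff_inv_mul_mem (hc : c ≠ 0) {x : K} : x ∈ c • N ↔ c⁻¹ * x ∈ N :=
  Set.mem_smul_set_iff_inv_smul_mem₀ hc (N : Set K) x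

theorem mul_mem_smul_iff (hc : c ≠ 0) {x : K} : c * x ∈ c • N ↔ x ∈ N := by
  rw [mem_smul_iff_inv_mul_mem hc, inv_mul_cancel_left₀ hc]

theorem smul_le_iff_le_inv_smul (hc : c ≠ 0) : c • N ≤ J ↔ N ≤ c⁻¹ • J :=
  Set.smul_set_subset_iff₀ hc

theorem smul_mul_eq_smul_mul : c • I * J = c • (I * J) := by
  rw [← Submodule.span_singleton_mul, mul_assoc, Submodule.span_singleton_mul]

theorem smul_colon (hc : c ≠ 0) : c • I / J = c • (I / J) := by
  ext x
  simp only [mem_smul_iff_inv_mul_mem hc, Submodule.mem_div_iff_forall_mul_mem, mul_assoc]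

theorem colon_smul (hc : c ≠ 0) : I / c • J = c⁻¹ • (I / J) :=
  eq_of_forall_le_iff fun P ↦ by
    rw [Submodule.le_div_iff_mul_le, mul_comm, smul_mul_eq_smul_mul, smul_le_iff_le_inv_smul hc,
      ← smul_colon (inv_ne_zero hc), Submodule.le_div_iff_mul_le, mul_comm]

variable {S : Subalgebra R K}

theorem le_subalgebra_mul : J ≤ S.toSubmodule * J :=
  le_mul_of_one_le_left' (Submodule.one_le.mpr S.one_mem)

theorem subalgebra_mul_subalgebra : S.toSubmodule * S.toSubmodule = S.toSubmodule :=
  S.isIdempotentElem_toSubmodule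

theorem subalgebra_mul_smul_le (h : S.toSubmodule * J ≤ J) : S.toSubmodule * c • J ≤ c • J := by
  rw [mul_comm, smul_mul_eq_smul_mul, mul_comm]
  exact Set.smul_set_mono h

theorem subalgebra_colon_self : S.toSubmodule / S.toSubmodule = S.toSubmodule := by
  refine le_antisymm (fun x hx ↦ ?_) (Submodule.le_div_iff_mul_le.mpr subalgebra_mul_subalgebra.le)
  simpa using hx 1 S.one_mem

theorem colon_colon_eq_of_colon_subalgebra (hc : c ≠ 0)
    (hω : ω / S.toSubmodule = c • S.toSubmodule) (hJ : S.toSubmodule * J ≤ J) :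
    ω / (ω / J) = S.toSubmodule / (S.toSubmodule / J) := by
  have colon_eq {N : Submodule R K} (hN : S.toSubmodule * N ≤ N) :
      ω / N = c • (S.toSubmodule / N) := by
    rw [← smul_colon hc, ← hω, ← colon_mul, hN.antisymm le_subalgebra_mul]
  rw [colon_eq hJ, colon_smul hc, colon_eq (mul_colon_le_colon subalgebra_mul_subalgebra.le),
    inv_smul_smul₀ hc]

end Colon

section CoeSubmodule

variable {R K : Type*} [CommRing R] [Field K] [Algebra R K] {I : Ideal R}

theorem coeSubmodule_le_one : coeSubmodule K I ≤ 1 := by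
  rintro _ ⟨a, -, rfl⟩
  exact Submodule.mem_one.mpr ⟨a, rfl⟩

theorem mem_colon_coeSubmodule {ω : Submodule R K} {u : K} :
    u ∈ ω / coeSubmodule K I ↔ ∀ a ∈ I, a • u ∈ ω := by
  simp [Submodule.mem_div_iff_forall_mul_mem, coeSubmodule, Algebra.smul_def, mul_comm u]

variable (K) [FaithfulSMul R K]

theorem algebraMap_mem_coeSubmodule {r : R} : algebraMap R K r ∈ coeSubmodule K I ↔ r ∈ I :=
  (FaithfulSMul.algebraMap_injective R K).mem_set_image

theorem coeSubmodule_ne_bot (hI : I ≠ ⊥) : coeSubmodule K I ≠ ⊥ := by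
  rw [← IsLocalization.coeSubmodule_bot K (R := R)]
  exact (Submodule.map_injective_of_injective (FaithfulSMul.algebraMap_injective R K)).ne hI

end CoeSubmodule

section Dualizing

variable {R K : Type*} [CommRing R] [Field K] [Algebra R K] {ω N : Submodule R K}

/-- The duality `ω : (ω : J) = J` for all nonzero finitely generated submodules `J` of `K`, which
over a Noetherian domain with fraction field `K` are the nonzero fractional ideals. Only the
inclusion which does not hold automatically is required. -/
def IsDualizing (ω : Submodule R K) : Prop :=
  ∀ J : Submodule R K, J.FG → J ≠ ⊥ → ω / (ω / J) ≤ J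

namespace IsDualizing

theorem colon_self_le_one (hω : IsDualizing ω) : ω / ω ≤ 1 := by
  simpa only [colon_one] using hω 1 fg_one one_ne_zero

variable [IsLocalRing R]

theorem colon_le_maximalIdeal (hω : IsDualizing ω) (hN : ω < N) :
    ω / N ≤ coeSubmodule K (maximalIdeal R) := by
  intro c hc
  obtain ⟨r, rfl⟩ := Submodule.mem_one.mp (hω.colon_self_le_one (colon_anti hN.le hc))
  refine ⟨r, (mem_maximalIdeal r).mpr fun hr ↦ hN.not_ge fun y hy ↦ ?_, rfl⟩
  rw [← ω.smul_mem_iff_of_isUnit hr, Algebra.smul_def]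
  exact hc y hy

theorem colon_maximalIdeal_le (hω : IsDualizing ω) (hN : ω < N) (hfg : N.FG) :
    ω / coeSubmodule K (maximalIdeal R) ≤ N :=
  (colon_anti (hω.colon_le_maximalIdeal hN)).trans (hω N hfg hN.ne_bot)

end IsDualizing

end Dualizing

section Socle

variable {A : Type*} [CommRing A] [IsDomain A] [IsLocalRing A] [IsNoetherianRing A]
  [Ring.KrullDimLE 1 A]

theorem exists_maximalIdeal_pow_le_span {r : A} (hr : r ≠ 0) :
    ∃ n : ℕ, maximalIdeal A ^ n ≤ Ideal.span {r} := by
  refine Ideal.exists_pow_le_of_le_radical_of_fg ?_ (IsNoetherian.noetherian _)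
  rw [Ideal.radical_eq_sInf]
  refine le_sInf fun P hP ↦ (eq_maximalIdeal (hP.2.isMaximal_of_ne_bot ?_)).ge
  rintro rfl
  exact hr ((Ideal.span_singleton_le_iff_mem _).mp hP.1)

theorem exists_smul_notMem_and_maximalIdeal_smul_mem {M : Type*} [AddCommGroup M] [Module A M]
    {N : Submodule A M} {z : M} (hz : z ∉ N) {r : A} (hr : r ≠ 0) (hrz : r • z ∈ N) :
    ∃ c : A, c • z ∉ N ∧ ∀ a ∈ maximalIdeal A, a • c • z ∈ N := by
  have exists_pow : ∃ n, ∀ a ∈ maximalIdeal A ^ n, a • z ∈ N := by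
    obtain ⟨n, hn⟩ := exists_maximalIdeal_pow_le_span hr
    refine ⟨n, fun a ha ↦ ?_⟩
    obtain ⟨b, rfl⟩ := Ideal.mem_span_singleton'.mp (hn ha)
    exact mul_smul b r z ▸ N.smul_mem b hrz
  classical
  obtain ⟨m, hm⟩ : ∃ m, Nat.find exists_pow = m + 1 := Nat.exists_eq_succ_of_ne_zero fun h ↦
    hz (by simpa using (Nat.find_eq_zero exists_pow).mp h 1 (by simp))
  obtain ⟨c, hc, hcz⟩ := by simpa using Nat.find_min exists_pow (m := m) (by simp [hm])
  refine ⟨c, hcz, fun a ha ↦ ?_⟩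
  rw [smul_smul]
  exact Nat.find_spec exists_pow _ (hm ▸ pow_succ' (maximalIdeal A) m ▸ Ideal.mul_mem_mul ha hc)

theorem exists_notMem_and_maximalIdeal_mul_mem {I : Ideal A} (hI : I ≠ ⊥) {J : Ideal A}
    (hJ : ¬J ≤ I) : ∃ t ∈ J, t ∉ I ∧ ∀ a ∈ maximalIdeal A, a * t ∈ I := by
  obtain ⟨r, hrI, hr⟩ := Submodule.exists_mem_ne_zero_of_ne_bot hI
  obtain ⟨z, hzJ, hzI⟩ := SetLike.not_le_iff_exists.mp hJ
  obtain ⟨c, hc, hac⟩ := exists_smul_notMem_and_maximalIdeal_smul_mem hzI hr (I.mul_mem_right z hrI)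
  exact ⟨c • z, J.smul_mem c hzJ, hc, hac⟩

end Socle

section Baer

variable {A : Type*} [CommRing A]

theorem exists_smul_eq_of_baer {Y : Type*} [AddCommGroup Y] [Module A Y] (hY : Module.Baer A Y)
    {I : Ideal A} {s : A} {y : Y} (h : ∀ c, c * s ∈ I → c • y = 0) :
    ∃ y' : Y, (∀ a ∈ I, a • y' = 0) ∧ s • y' = y := by
  let f : (A ⧸ I) →ₗ.[A] Y := LinearPMap.mkSpanSingleton' (I.mkQ s) y fun c hc ↦
    h c (by rwa [← map_smul, Submodule.mkQ_apply, Submodule.Quotient.mk_eq_zero] at hc)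
  obtain ⟨g, hg⟩ := hY.extension_property f.domain.subtype f.domain.subtype_injective f.toFun
  have smul_g (a : A) : a • g (I.mkQ 1) = g (I.mkQ a) := by
    rw [← map_smul, ← map_smul, smul_eq_mul, mul_one]
  refine ⟨g (I.mkQ 1), fun a ha ↦ ?_, ?_⟩
  · rw [smul_g, Submodule.mkQ_apply, (Submodule.Quotient.mk_eq_zero I).mpr ha, map_zero]
  · rw [smul_g]
    exact (LinearMap.congr_fun hg ⟨_, Submodule.mem_span_singleton_self _⟩).trans
      (LinearPMap.mkSpanSingleton'_apply_self _ _ _ _)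

theorem baer_iff_exists_smul {X : Type*} [AddCommGroup X] [Module A X] : Module.Baer A X ↔
    ∀ (I : Ideal A) (g : I →ₗ[A] X), ∃ e : X, ∀ a : I, g a = (a : A) • e := by
  refine forall₂_congr fun I g ↦ ⟨fun ⟨g', hg'⟩ ↦ ⟨g' 1, fun a ↦ ?_⟩,
    fun ⟨e, he⟩ ↦ ⟨LinearMap.toSpanSingleton A X e, fun a ha ↦ (he ⟨a, ha⟩).symm⟩⟩
  rw [← map_smul, smul_eq_mul, mul_one, hg' a a.2]

theorem surjective_smul_of_baer [IsDomain A] {X : Type*} [AddCommGroup X] [Module A X]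
    (hX : Module.Baer A X) {a : A} (ha : a ≠ 0) : Function.Surjective fun w : X ↦ a • w :=
  fun v ↦ (exists_smul_eq_of_baer (I := ⊥) hX fun c hc ↦ by
    rw [(mul_eq_zero_iff_right ha).mp hc, zero_smul]).imp fun _ h ↦ h.2

end Baer

section DivisibleModules

variable {A : Type*} [CommRing A] [IsDomain A] [IsLocalRing A] [IsNoetherianRing A]
  [Ring.KrullDimLE 1 A]
  {X Y E : Type*} [AddCommGroup X] [Module A X] [AddCommGroup E] [Module A E]
  [AddCommGroup Y] [Module A Y] {f : X →ₗ[A] E} {p : E →ₗ[A] Y}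

-- Let `s` generate a simple submodule of `A / x`. Extending `s ↦ y` to `A / x → Y` gives `u` with
-- `s • u = y` and `x • u = 0`, and divisibility of `X` corrects a lift of `u` to be killed by `x`.
theorem exists_socle_lift (hA : ¬IsField A) (hp : Function.Surjective p) (hfp : Function.Exact f p)
    (hX : ∀ a : A, a ≠ 0 → Function.Surjective fun w : X ↦ a • w) (hY : Module.Baer A Y)
    {y : Y} (hy : ∀ a ∈ maximalIdeal A, a • y = 0) :
    ∃ z : E, p z = y ∧ ∀ a ∈ maximalIdeal A, a • z = 0 := by
  obtain ⟨x, hxm, hx⟩ :=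
    Submodule.exists_mem_ne_zero_of_ne_bot (isField_iff_maximalIdeal_eq.not.mp hA)
  obtain ⟨s, -, hs, hms⟩ := exists_notMem_and_maximalIdeal_mul_mem (I := Ideal.span {x}) (J := ⊤)
    (by simpa using hx) (by simpa [top_le_iff, Ideal.span_singleton_eq_top] using hxm)
  obtain ⟨y', hxy', rfl⟩ := exists_smul_eq_of_baer hY (I := Ideal.span {x}) (s := s) (y := y)
    fun c hc ↦ hy c ((mem_maximalIdeal c).mpr fun hu ↦ hs ((Ideal.unit_mul_mem_iff_mem _ hu).mp hc))
  obtain ⟨z, rfl⟩ := hp y'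
  obtain ⟨v, hv⟩ := (hfp (x • z)).mp (by rw [map_smul, hxy' x (Ideal.mem_span_singleton_self x)])
  obtain ⟨w, rfl⟩ := hX x hx v
  refine ⟨s • (z - f w), by simp [hfp.apply_apply_eq_zero], fun a ha ↦ ?_⟩
  obtain ⟨b, hb⟩ := Ideal.mem_span_singleton'.mp (hms a ha)
  rw [smul_smul, ← hb, mul_smul, smul_sub x, ← map_smul f, ← hv, sub_self, smul_zero]

theorem exists_annihilated_lift (hp : Function.Surjective p) (hE : Module.Baer A E)
    (hsoc : ∀ y : Y, (∀ a ∈ maximalIdeal A, a • y = 0) →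
      ∃ z : E, p z = y ∧ ∀ a ∈ maximalIdeal A, a • z = 0)
    (J : Ideal A) {y : Y} (hy : ∀ a ∈ J, a • y = 0) :
    ∃ z : E, p z = y ∧ ∀ a ∈ J, a • z = 0 := by
  induction J using WellFoundedGT.induction generalizing y with
  | ind J ih =>
  rcases eq_or_ne J ⊥ with rfl | hbot
  · simpa using hp y
  by_cases htop : ⊤ ≤ J
  · exact ⟨0, by simpa using (hy 1 (htop trivial)).symm, by simp⟩
  obtain ⟨t, -, ht, hmt⟩ := exists_notMem_and_maximalIdeal_mul_mem hbot htop
  obtain ⟨u, hu, hmu⟩ := hsoc (t • y) fun a ha ↦ by rw [smul_smul, hy _ (hmt a ha)]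
  obtain ⟨w, hJw, rfl⟩ := exists_smul_eq_of_baer hE (I := J) (s := t) (y := u)
    fun c hc ↦ hmu c ((mem_maximalIdeal c).mpr fun h ↦ ht ((Ideal.unit_mul_mem_iff_mem _ h).mp hc))
  have hlt : J < J ⊔ Ideal.span {t} := by simpa using ht
  have htw : t • (y - p w) = 0 := by rw [smul_sub, ← map_smul, hu, sub_self]
  have hyw : ∀ a ∈ J ⊔ Ideal.span {t}, a • (y - p w) = 0 := by
    intro a ha
    obtain ⟨b, hb, c, hc, rfl⟩ := Submodule.mem_sup.mp ha
    obtain ⟨d, rfl⟩ := Ideal.mem_span_singleton'.mp hc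
    rw [add_smul, mul_smul, htw, smul_zero, add_zero, smul_sub, hy b hb, ← map_smul, hJw b hb,
      map_zero, sub_zero]
  obtain ⟨z, hz, hJz⟩ := ih _ hlt hyw
  exact ⟨z + w, by rw [map_add, hz, sub_add_cancel], fun a ha ↦ by
    rw [smul_add, hJz a (hlt.le ha), hJw a ha, add_zero]⟩

theorem baer_of_exact (hA : ¬IsField A) (hf : Function.Injective f) (hp : Function.Surjective p)
    (hfp : Function.Exact f p) (hX : ∀ a : A, a ≠ 0 → Function.Surjective fun w : X ↦ a • w)
    (hE : Module.Baer A E) (hY : Module.Baer A Y) : Module.Baer A X := by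
  refine baer_iff_exists_smul.mpr fun J g ↦ ?_
  obtain ⟨e, he⟩ := baer_iff_exists_smul.mp hE J (f ∘ₗ g)
  obtain ⟨z, hz, hJz⟩ := exists_annihilated_lift hp hE
    (fun y hy ↦ exists_socle_lift hA hp hfp hX hY hy) J (y := p e) fun a ha ↦ by
      rw [← map_smul, ← he ⟨a, ha⟩, LinearMap.comp_apply, hfp.apply_apply_eq_zero]
  obtain ⟨e', he'⟩ := (hfp (e - z)).mp (by rw [map_sub, hz, sub_self])
  refine ⟨e', fun a ↦ hf ?_⟩
  rw [map_smul, he', smul_sub, hJz a a.2, sub_zero, ← he, LinearMap.comp_apply]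

end DivisibleModules

universe u

section Field

variable {A K : Type*} [CommRing A] [Field K] [Algebra A K]

theorem smul_mkQ_eq_zero_iff {ω : Submodule A K} {a : A} {u : K} :
    a • ω.mkQ u = 0 ↔ a • u ∈ ω := by
  rw [← map_smul, Submodule.mkQ_apply, Submodule.Quotient.mk_eq_zero]

variable [FaithfulSMul A K]

theorem surjective_smul_quotient (N : Submodule A K) {a : A} (ha : a ≠ 0) :
    Function.Surjective fun w : K ⧸ N ↦ a • w := by
  intro v
  obtain ⟨v, rfl⟩ := N.mkQ_surjective v
  refine ⟨N.mkQ ((algebraMap A K a)⁻¹ * v), ?_⟩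
  dsimp only
  rw [← map_smul, Algebra.smul_def, mul_inv_cancel_left₀ (by simpa using ha)]

theorem baer_field : Module.Baer A K := by
  refine baer_iff_exists_smul.mpr fun I g ↦ ?_
  rcases eq_or_ne I ⊥ with rfl | hI
  · exact ⟨0, fun a ↦ by rw [Subsingleton.elim a 0, map_zero, smul_zero]⟩
  obtain ⟨r, hrI, hr⟩ := Submodule.exists_mem_ne_zero_of_ne_bot hI
  have hr' : algebraMap A K r ≠ 0 := by simpa using hr
  refine ⟨g ⟨r, hrI⟩ / algebraMap A K r, fun a ↦ ?_⟩
  have comm : r • a = (a : A) • ⟨r, hrI⟩ := Subtype.ext (mul_comm r a)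
  rw [Algebra.smul_def, mul_div_assoc', eq_div_iff hr', mul_comm, ← Algebra.smul_def,
    ← Algebra.smul_def, ← map_smul, ← map_smul, comm]

end Field

section InjectiveDimension

open CategoryTheory

theorem hasInjectiveDimensionLE_zero_iff_baer {A : Type u} [CommRing A] (X : ModuleCat.{u} A) :
    HasInjectiveDimensionLE X 0 ↔ Module.Baer A X := by
  rw [Module.Baer.iff_injective, Module.injective_iff_injective_object]
  exact injective_iff_hasInjectiveDimensionLT_one.symm

variable {A : Type u} [CommRing A] [IsDomain A] [IsLocalRing A] [IsNoetherianRing A]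
  [Ring.KrullDimLE 1 A]

theorem baer_of_hasInjectiveDimensionLE (hA : ¬IsField A) {n : ℕ} {X : ModuleCat.{u} A}
    (h : HasInjectiveDimensionLE X n)
    (hX : ∀ a : A, a ≠ 0 → Function.Surjective fun w : X ↦ a • w) : Module.Baer A X := by
  induction n generalizing X with
  | zero => exact (hasInjectiveDimensionLE_zero_iff_baer X).mp h
  | succ n ih =>
    obtain ⟨E, hE, f, hf⟩ := EnoughInjectives.presentation X
    have hE' : Module.Baer A E :=
      Module.Baer.of_injective (Module.injective_module_of_injective_object A E)
    have inj : Function.Injective f.hom := (ModuleCat.mono_iff_injective f).mp hf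
    have surj := f.hom.range.mkQ_surjective
    have exact_mkQ := f.hom.exact_map_mkQ_range
    have shortExact := ModuleCat.shortComplex_shortExact
      (ModuleCat.shortComplexOfCompEqZero _ _ exact_mkQ.linearMap_comp_eq_zero) exact_mkQ inj surj
    have hY : Module.Baer A (E ⧸ f.hom.range) := by
      refine ih ((shortExact.hasInjectiveDimensionLT_X₃_iff n hE).mpr h) fun a ha v ↦ ?_
      obtain ⟨v, rfl⟩ := surj v
      obtain ⟨w, rfl⟩ := surjective_smul_of_baer hE' ha v
      exact ⟨f.hom.range.mkQ w, (map_smul _ _ _).symm⟩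
    exact baer_of_exact hA inj surj exact_mkQ hX hE' hY

theorem exists_hasInjectiveDimensionLE_iff_baer (hA : ¬IsField A) {K : Type u} [Field K]
    [Algebra A K] [FaithfulSMul A K] :
    (∃ n : ℕ, HasInjectiveDimensionLE (ModuleCat.of A A) n) ↔
      Module.Baer A (K ⧸ (1 : Submodule A K)) := by
  rw [Submodule.one_eq_range]
  have exact_mkQ := (Algebra.linearMap A K).exact_map_mkQ_range
  have shortExact := ModuleCat.shortComplex_shortExact
    (ModuleCat.shortComplexOfCompEqZero _ _ exact_mkQ.linearMap_comp_eq_zero) exact_mkQ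
    (FaithfulSMul.algebraMap_injective A K) (Submodule.mkQ_surjective _)
  have hK : Injective (ModuleCat.of A K) := by
    rw [← Module.injective_iff_injective_object, ← Module.Baer.iff_injective]
    exact baer_field
  constructor
  · rintro ⟨n, hn⟩
    exact baer_of_hasInjectiveDimensionLE hA ((shortExact.hasInjectiveDimensionLT_X₃_iff n hK).mpr
      (hasInjectiveDimensionLT_of_ge (ModuleCat.of A A) (n + 1) (n + 2) (by lia)))
      fun a ha ↦ surjective_smul_quotient _ ha
  · intro h
    exact ⟨1, (shortExact.hasInjectiveDimensionLT_X₃_iff 0 hK).mp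
      ((hasInjectiveDimensionLE_zero_iff_baer _).mpr h)⟩

end InjectiveDimension

section Gorenstein

variable {A K : Type*} [CommRing A] [IsDomain A] [IsLocalRing A] [IsNoetherianRing A]
  [Ring.KrullDimLE 1 A] [Field K] [Algebra A K]

theorem baer_of_forall_simple {X : Type*} [AddCommGroup X] [Module A X]
    (hX : ∀ a : A, a ≠ 0 → Function.Surjective fun w : X ↦ a • w)
    (h : ∀ (N : Ideal A) (t : A) (y : X), N ≠ ⊥ → t ∉ N → (∀ a ∈ maximalIdeal A, a * t ∈ N) →
      (∀ a ∈ maximalIdeal A, a • y = 0) → ∃ e : X, (∀ a ∈ N, a • e = 0) ∧ t • e = y) :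
    Module.Baer A X := by
  refine baer_iff_exists_smul.mpr fun I g ↦ ?_
  rcases eq_or_ne I ⊥ with rfl | hI
  · exact ⟨0, fun a ↦ by rw [Subsingleton.elim a 0, map_zero, smul_zero]⟩
  obtain ⟨r, hrI, hr⟩ := Submodule.exists_mem_ne_zero_of_ne_bot hI
  let L (e : X) : Submodule A I := g.eqLocus (LinearMap.toSpanSingleton A X e ∘ₗ I.subtype)
  have mem_L {e : X} {a : I} : a ∈ L e ↔ g a = (a : A) • e := Iff.rfl
  obtain ⟨e, hre, hmax⟩ : ∃ e, MaximalFor (⟨r, hrI⟩ ∈ L ·) L e :=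
    exists_maximalFor_of_wellFoundedGT _ L ((hX r hr (g ⟨r, hrI⟩)).imp fun _ he ↦ he.symm)
  refine ⟨e, fun a ↦ mem_L.mp (by_contra fun ha ↦ ?_)⟩
  have mul_mem : r • a ∈ L e := by
    have : r • a = (a : A) • ⟨r, hrI⟩ := Subtype.ext (mul_comm r a)
    exact this ▸ (L e).smul_mem (a : A) hre
  obtain ⟨c, hc, hmc⟩ := exists_smul_notMem_and_maximalIdeal_smul_mem ha hr mul_mem
  generalize c • a = t at hc hmc
  have mem_map {b : I} : (b : A) ∈ (L e).map I.subtype ↔ b ∈ L e :=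
    I.subtype_injective.mem_set_image
  obtain ⟨e', hLe', hte'⟩ := h ((L e).map I.subtype) t (g t - (t : A) • e)
    (fun hbot ↦ hr (by simpa [hbot] using mem_map.mpr hre)) (mem_map.not.mpr hc)
    (fun b hb ↦ mem_map.mpr (hmc b hb)) fun b hb ↦ by
      rw [smul_sub, ← map_smul, mem_L.mp (hmc b hb), Submodule.coe_smul, smul_assoc, sub_self]
  have hle : L e ≤ L (e + e') := fun b hb ↦ by
    rw [mem_L, smul_add, hLe' b (mem_map.mpr hb), add_zero, mem_L.mp hb]
  refine hc (hmax (hle hre) hle ?_)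
  rw [mem_L, smul_add, hte', add_sub_cancel]

theorem IsDualizing.baer_quotient [FaithfulSMul A K] {ω : Submodule A K} (hω : IsDualizing ω)
    (hfg : ω.FG) : Module.Baer A (K ⧸ ω) := by
  refine baer_of_forall_simple (fun a ha ↦ surjective_smul_quotient ω ha) ?_
  intro N t v hN ht _ hv
  obtain ⟨u, rfl⟩ := ω.mkQ_surjective v
  obtain ⟨y, hy, hyt⟩ : ∃ y ∈ ω / coeSubmodule K N, t • y ∉ ω := by
    by_contra! h
    refine ht ((algebraMap_mem_coeSubmodule K).mp (hω _ ((IsNoetherian.noetherian N).map _)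
      (coeSubmodule_ne_bot K hN) fun y hy ↦ Algebra.smul_def t y ▸ h y hy))
  rw [mem_colon_coeSubmodule] at hy
  have hu : u ∈ ω ⊔ Submodule.span A {t • y} :=
    hω.colon_maximalIdeal_le (by simpa using hyt) (hfg.sup (Submodule.fg_span_singleton _))
      (mem_colon_coeSubmodule.mpr fun a ha ↦ smul_mkQ_eq_zero_iff.mp (hv a ha))
  obtain ⟨w, hw, z, hz, rfl⟩ := Submodule.mem_sup.mp hu
  obtain ⟨r, rfl⟩ := Submodule.mem_span_singleton.mp hz
  refine ⟨r • ω.mkQ y, fun a ha ↦ ?_, ?_⟩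
  · rw [smul_comm, smul_mkQ_eq_zero_iff.mpr (hy a ha), smul_zero]
  · rw [map_add, Submodule.mkQ_apply _ w, (Submodule.Quotient.mk_eq_zero ω).mpr hw, zero_add,
      map_smul, map_smul, smul_comm]

theorem not_one_colon_maximalIdeal_le [FaithfulSMul A K] (hA : ¬IsField A) :
    ¬(1 : Submodule A K) / coeSubmodule K (maximalIdeal A) ≤ 1 := by
  obtain ⟨x, hxm, hx⟩ :=
    Submodule.exists_mem_ne_zero_of_ne_bot (isField_iff_maximalIdeal_eq.not.mp hA)
  have hx' : algebraMap A K x ≠ 0 := by simpa using hx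
  have inv_notMem : (algebraMap A K x)⁻¹ ∉ (1 : Submodule A K) := by
    intro h
    obtain ⟨y, hy⟩ := Submodule.mem_one.mp h
    refine hxm (IsUnit.of_mul_eq_one y (FaithfulSMul.algebraMap_injective A K ?_))
    rw [map_mul, map_one, hy, mul_inv_cancel₀ hx']
  obtain ⟨c, hc, hmc⟩ := exists_smul_notMem_and_maximalIdeal_smul_mem inv_notMem hx
    (by rw [Algebra.smul_def, mul_inv_cancel₀ hx']; exact Submodule.one_le.mp le_rfl)
  exact fun h ↦ hc (h (mem_colon_coeSubmodule.mpr hmc))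

end Gorenstein

theorem isDualizing_of_baer_quotient {A K : Type*} [CommRing A] [IsLocalRing A] [Field K]
    [Algebra A K] [IsFractionRing A K] {ω : Submodule A K}
    (hE : Module.Baer A (K ⧸ ω)) (hω : ¬ω / coeSubmodule K (maximalIdeal A) ≤ ω) :
    IsDualizing ω := by
  intro J hJ _ z hz
  by_contra hzJ
  obtain ⟨u, hu, huω⟩ := SetLike.not_le_iff_exists.mp hω
  rw [mem_colon_coeSubmodule] at hu
  obtain ⟨d, hd, hint⟩ : IsFractional A⁰ (J ⊔ Submodule.span A {z}) :=
    FractionalIdeal.isFractional_of_fg (hJ.sup (Submodule.fg_span_singleton z))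
  have hd0 : algebraMap A K d ≠ 0 := by simpa using nonZeroDivisors.ne_zero hd
  obtain ⟨s, hs⟩ := hint z (Submodule.mem_sup_right (Submodule.mem_span_singleton_self z))
  let I : Ideal A := (algebraMap A K d • J).comap (Algebra.linearMap A K)
  rw [Algebra.smul_def] at hs
  obtain ⟨v, hIv, hsv⟩ := exists_smul_eq_of_baer hE (I := I) (s := s) (y := ω.mkQ u) fun c hc ↦ by
    refine smul_mkQ_eq_zero_iff.mpr (hu c ((mem_maximalIdeal c).mpr fun hcu ↦ hzJ ?_))
    rw [← J.smul_mem_iff_of_isUnit hcu, ← mul_mem_smul_iff hd0, mul_smul_comm, ← hs,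
      Algebra.smul_def, ← map_mul]
    exact hc
  obtain ⟨y, rfl⟩ := ω.mkQ_surjective v
  have hdy : algebraMap A K d * y ∈ ω / J := fun j hj ↦ by
    obtain ⟨a, ha⟩ := hint j (Submodule.mem_sup_left hj)
    rw [mul_right_comm, ← Algebra.smul_def, ← ha, ← Algebra.smul_def, ← smul_mkQ_eq_zero_iff]
    refine hIv a ?_
    rw [Submodule.mem_comap, Algebra.linearMap_apply, ha, Algebra.smul_def, mul_mem_smul_iff hd0]
    exact hj
  have hsy : s • y ∈ ω := by
    rw [Algebra.smul_def, hs, mul_assoc, mul_left_comm]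
    exact hz _ hdy
  refine huω ((Submodule.Quotient.mk_eq_zero ω).mp ?_)
  rw [← Submodule.mkQ_apply, ← hsv, smul_mkQ_eq_zero_iff.mpr hsy]

theorem isGorensteinLocalRing_iff_isDualizing_one {A K : Type u} [CommRing A] [IsDomain A]
    [IsLocalRing A] [IsNoetherianRing A] [Ring.KrullDimLE 1 A] (hA : ¬IsField A) [Field K]
    [Algebra A K] [IsFractionRing A K] :
    IsGorensteinLocalRing A ↔ IsDualizing (1 : Submodule A K) := by
  rw [IsGorensteinLocalRing, exists_hasInjectiveDimensionLE_iff_baer hA (K := K)]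
  refine ⟨fun ⟨_, _, h⟩ ↦ isDualizing_of_baer_quotient h (not_one_colon_maximalIdeal_le hA),
    fun h ↦ ⟨‹_›, ‹_›, h.baer_quotient fg_one⟩⟩

section CanonicalIdeal

variable {R K : Type*} [CommRing R] [IsDomain R] [Field K] [Algebra R K] [IsFractionRing R K]

theorem colon_ne_zero {ω J : FractionalIdeal R⁰ K} (hω : ω ≠ 0) (hJ : J ≠ 0) : ω / J ≠ 0 := by
  intro h
  let d := FractionalIdeal.spanSingleton R⁰ (algebraMap R K J.den)
  have hd : d * d⁻¹ = 1 := FractionalIdeal.spanSingleton_mul_inv K (by simp)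
  have mul_le : ω * d ≤ ω / J := by
    rw [FractionalIdeal.le_div_iff_mul_le hJ, mul_assoc, FractionalIdeal.den_mul_self_eq_num']
    exact mul_le_of_le_one_right' FractionalIdeal.coeIdeal_le_one
  refine hω ?_
  rw [← mul_one ω, ← hd, ← mul_assoc, FractionalIdeal.le_zero_iff.mp (mul_le.trans_eq h), zero_mul]

theorem isCanonicalIdeal_iff [IsNoetherianRing R] {ω : FractionalIdeal R⁰ K} :
    IsCanonicalIdeal ω ↔ ω ≠ 0 ∧ IsDualizing (ω : Submodule R K) := by
  refine and_congr_right fun hω ↦ ⟨fun h J hJ hJ0 ↦ ?_, fun h J hJ ↦ ?_⟩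
  · let J' : FractionalIdeal R⁰ K := ⟨J, FractionalIdeal.isFractional_of_fg hJ⟩
    have hJ' : J' ≠ 0 := FractionalIdeal.coeToSubmodule_ne_bot.mp hJ0
    have hdiv := h J' hJ'
    rw [← FractionalIdeal.coeToSubmodule_inj, FractionalIdeal.coe_div (colon_ne_zero hω hJ'),
      FractionalIdeal.coe_div hJ'] at hdiv
    exact hdiv.le
  · rw [← FractionalIdeal.coeToSubmodule_inj, FractionalIdeal.coe_div (colon_ne_zero hω hJ),
      FractionalIdeal.coe_div hJ]
    exact (h J (J.fg_of_isNoetherianRing le_rfl)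
      (FractionalIdeal.coeToSubmodule_ne_bot.mpr hJ)).antisymm le_colon_colon

end CanonicalIdeal

section Overring

variable {R K : Type*} [CommRing R] [Field K] [Algebra R K] {S : Subalgebra R K}

theorem exists_restrictScalars_eq {J : Submodule R K} (hJ : S.toSubmodule * J ≤ J) :
    ∃ J' : Submodule S K, J'.restrictScalars R = J :=
  ⟨{ J with smul_mem' := fun s _ hj ↦ hJ (Submodule.mul_mem_mul s.2 hj) }, rfl⟩

theorem subalgebra_mul_restrictScalars_le (J : Submodule S K) :
    S.toSubmodule * J.restrictScalars R ≤ J.restrictScalars R :=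
  Submodule.mul_le.mpr fun s hs _ hj ↦ J.smul_mem ⟨s, hs⟩ hj

theorem restrictScalars_one_colon (J : Submodule S K) :
    ((1 : Submodule S K) / J).restrictScalars R = S.toSubmodule / J.restrictScalars R := by
  ext x
  simp [Submodule.mem_div_iff_forall_mul_mem]

variable [Module.Finite R S]

theorem isDualizing_one_iff : IsDualizing (1 : Submodule S K) ↔
    ∀ J : Submodule R K, J.FG → J ≠ ⊥ → S.toSubmodule * J ≤ J →
      S.toSubmodule / (S.toSubmodule / J) ≤ J := by
  constructor
  · intro h J hJ hJ0 hSJ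
    obtain ⟨J, rfl⟩ := exists_restrictScalars_eq hSJ
    rw [← restrictScalars_one_colon, ← restrictScalars_one_colon]
    exact h J hJ.of_restrictScalars fun h ↦ hJ0 (by rw [h, Submodule.restrictScalars_bot])
  · intro h J hJ hJ0
    have hJR := h (J.restrictScalars R) hJ.restrictScalars
      (by rwa [Ne, Submodule.restrictScalars_eq_bot_iff]) (subalgebra_mul_restrictScalars_le J)
    rwa [← restrictScalars_one_colon, ← restrictScalars_one_colon] at hJR

theorem fg_of_le_subalgebra [IsNoetherianRing R] {N : Submodule R K} (hN : N ≤ S.toSubmodule) :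
    N.FG :=
  Submodule.FG.of_le (Module.Finite.iff_fg.mp ‹_›) hN

theorem subalgebra_le_integralClosure : S ≤ integralClosure R K := by
  rw [le_integralClosure_iff_isIntegral]
  infer_instance

theorem krullDimLE_one_of_finite [IsDomain R] [Ring.KrullDimLE 1 R] : Ring.KrullDimLE 1 S := by
  rw [Ring.krullDimLE_one_iff_of_noZeroDivisors]
  intro P hP hPp
  exact Ideal.isMaximal_of_isIntegral_of_isMaximal_comap P
    (Ideal.IsPrime.isMaximal_of_ne_bot inferInstance (Ideal.IsIntegral.comap_ne_bot R hP))

theorem isLocalRing_of_finite [IsLocalRing (integralClosure R K)] : IsLocalRing S := by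
  let f : S →+* integralClosure R K :=
    (Subalgebra.inclusion subalgebra_le_integralClosure).toRingHom
  have : IsLocalHom f := by
    refine RingHom.IsIntegral.isLocalHom (fun y ↦ ?_) (Subalgebra.inclusion_injective _)
    obtain ⟨p, hp, hpy⟩ : IsIntegral R y := Algebra.IsIntegral.isIntegral y
    exact ⟨p.map (algebraMap R S), hp.map _, by rwa [Polynomial.eval₂_map]⟩
  exact f.domain_isLocalRing

end Overring

section BlowUp

variable {R K : Type*} [CommRing R] [Field K] [Algebra R K]

theorem smul_pow_eq_pow_smul_pow (c : K) (I : Submodule R K) (n : ℕ) :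
    (c • I) ^ n = c ^ n • I ^ n := by
  rw [← Submodule.span_singleton_mul, mul_pow, Submodule.span_pow, Set.singleton_pow,
    Submodule.span_singleton_mul]

theorem exists_pow_succ_eq_pow [IsNoetherianRing R] {B : Submodule R K} (hfg : B.FG)
    (hone : 1 ≤ B) (hint : B ≤ (integralClosure R K).toSubmodule) :
    ∃ n : ℕ, B ^ (n + 1) = B ^ n := by
  obtain ⟨F, rfl⟩ := hfg
  let P := Algebra.adjoin R (F : Set K)
  have hP : IsNoetherian R P.toSubmodule := isNoetherian_of_fg_of_noetherian _
    (fg_adjoin_of_finite F.finite_toSet fun x hx ↦ hint (Submodule.subset_span hx))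
  have pow_le (n : ℕ) : Submodule.span R (F : Set K) ^ n ≤ P.toSubmodule := by
    rw [Submodule.span_pow, Submodule.span_le]
    exact Submonoid.pow_subset (S := P.toSubmonoid) Algebra.subset_adjoin
  obtain ⟨n, hn⟩ := monotone_stabilizes_iff_noetherian.mpr hP
    ⟨fun n ↦ (Submodule.span R (F : Set K) ^ n).comap P.toSubmodule.subtype,
      fun _ _ h ↦ Submodule.comap_mono (pow_le_pow_right' hone h)⟩
  have hle := Submodule.comap_subtype_le_iff.mp (hn (n + 1) n.le_succ).ge
  rw [inf_eq_right.mpr (pow_le _), inf_eq_right.mpr (pow_le _)] at hle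
  exact ⟨n, hle.antisymm (pow_le_pow_right' hone n.le_succ)⟩

variable [IsLocalRing R] [IsFractionRing R K]

theorem exists_smul_maximalIdeal_le_integralClosure
    [IsDiscreteValuationRing (integralClosure R K)] (hR : ¬IsField R) :
    ∃ x ∈ coeSubmodule K (maximalIdeal R), x ≠ 0 ∧
      x⁻¹ • coeSubmodule K (maximalIdeal R) ≤ (integralClosure R K).toSubmodule := by
  let v (a : R) : ℕ∞ := IsDiscreteValuationRing.addVal (integralClosure R K) (algebraMap R _ a)
  obtain ⟨x, ⟨hx, hx0⟩, hmin⟩ : ∃ x, MinimalFor (fun a ↦ a ∈ maximalIdeal R ∧ a ≠ 0) v x :=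
    exists_minimalFor_of_wellFoundedLT _ v
      (Submodule.exists_mem_ne_zero_of_ne_bot (isField_iff_maximalIdeal_eq.not.mp hR))
  have hxK : algebraMap R K x ≠ 0 := by simpa using hx0
  refine ⟨algebraMap R K x, ⟨x, hx, rfl⟩, hxK, ?_⟩
  rw [smul_le_iff_le_inv_smul (inv_ne_zero hxK), inv_inv]
  rintro _ ⟨u, hu, rfl⟩
  rcases eq_or_ne u 0 with rfl | hu0
  · exact map_zero (Algebra.linearMap R K) ▸ zero_mem _
  obtain ⟨y, hy⟩ := IsDiscreteValuationRing.addVal_le_iff_dvd.mp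
    ((le_total (v x) (v u)).elim id (hmin ⟨hu, hu0⟩))
  rw [mem_smul_iff_inv_mul_mem hxK]
  have : algebraMap R K u = algebraMap R K x * y := congrArg Subtype.val hy
  rw [Algebra.linearMap_apply, this, inv_mul_cancel_left₀ hxK]
  exact y.2

theorem exists_maximalIdeal_eq_smul_blowUp [IsNoetherianRing R]
    [IsDiscreteValuationRing (integralClosure R K)] (hR : ¬IsField R)
    (hstable : IsStableMaximalIdeal R K) :
    ∃ x : K, x ≠ 0 ∧
      coeSubmodule K (maximalIdeal R) = x • (blowUp R K (maximalIdeal R)).toSubmodule := by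
  obtain ⟨x, hx, hx0, hint⟩ := exists_smul_maximalIdeal_le_integralClosure (K := K) hR
  obtain ⟨B, hB⟩ : ∃ B, coeSubmodule K (maximalIdeal R) = x • B := ⟨_, (smul_inv_smul₀ hx0 _).symm⟩
  rw [hB, inv_smul_smul₀ hx0] at hint
  have one_le : 1 ≤ B := by
    rwa [Submodule.one_le, ← mul_mem_smul_iff hx0, mul_one, ← hB]
  have hfg : B.FG := by
    rw [← inv_smul_smul₀ hx0 B, ← hB]
    exact fg_smul ((IsNoetherian.noetherian (maximalIdeal R)).map _)
  obtain ⟨n, hn⟩ := exists_pow_succ_eq_pow hfg one_le hint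
  have le_blowUp : B ≤ (blowUp R K (maximalIdeal R)).toSubmodule := by
    refine fun y hy ↦ ⟨n, ?_⟩
    rw [hB, smul_pow_eq_pow_smul_pow, smul_colon (pow_ne_zero n hx0),
      colon_smul (pow_ne_zero n hx0), smul_inv_smul₀ (pow_ne_zero n hx0)]
    exact Submodule.le_div_iff_mul_le.mpr (pow_succ' B n ▸ hn.le) hy
  have blowUp_le : (blowUp R K (maximalIdeal R)).toSubmodule ≤ B := by
    intro y hy
    rw [hstable] at hy
    rw [← mul_mem_smul_iff hx0, ← hB, mul_comm]
    exact hy x hx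
  exact ⟨x, hx0, hB.trans (congrArg (x • ·) (le_blowUp.antisymm blowUp_le))⟩

end BlowUp

section ColonDuality

variable {R K : Type*} [CommRing R] [Field K] [Algebra R K] {ω N J : Submodule R K} {t y : K}

theorem mem_colon_sup_span_singleton :
    y ∈ ω / (N ⊔ Submodule.span R {t}) ↔ y ∈ ω / N ∧ y * t ∈ ω := by
  simp only [← Submodule.span_singleton_le_iff_mem (R := R), Submodule.le_div_iff_mul_le,
    Submodule.mul_sup, sup_le_iff, Submodule.span_mul_span, Set.singleton_mul_singleton]

variable [IsLocalRing R]

theorem colon_le_colon_sup_span_singleton_sup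
    (hω : ω ⩿ ω / coeSubmodule K (maximalIdeal R)) (ht : ∀ a ∈ maximalIdeal R, a • t ∈ N)
    (hy : y ∈ ω / N) (hyt : y * t ∉ ω) :
    ω / N ≤ ω / (N ⊔ Submodule.span R {t}) ⊔ Submodule.span R {y} := by
  have mul_mem {q : K} (hq : q ∈ ω / N) : q * t ∈ ω / coeSubmodule K (maximalIdeal R) :=
    mem_colon_coeSubmodule.mpr fun a ha ↦ mul_smul_comm a q t ▸ hq _ (ht a ha)
  have sup_eq : ω ⊔ Submodule.span R {y * t} = ω / coeSubmodule K (maximalIdeal R) :=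
    (hω.eq_or_eq le_sup_left (sup_le hω.le
      ((Submodule.span_singleton_le_iff_mem _ _).mpr (mul_mem hy)))).resolve_left (by simpa)
  intro q hq
  obtain ⟨w, hw, z, hz, hwz⟩ := Submodule.mem_sup.mp (sup_eq ▸ mul_mem hq)
  obtain ⟨r, rfl⟩ := Submodule.mem_span_singleton.mp hz
  refine Submodule.mem_sup.mpr ⟨q - r • y, mem_colon_sup_span_singleton.mpr ⟨?_, ?_⟩, r • y,
    Submodule.smul_mem _ r (Submodule.mem_span_singleton_self y), sub_add_cancel _ _⟩
  · exact sub_mem hq (Submodule.smul_mem _ r hy)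
  · rwa [sub_mul, smul_mul_assoc, ← hwz, add_sub_cancel_right]

-- The roles of `t` and `y` are symmetric: adjoining `t` to `N` removes the generator `y` from
-- `ω : N`, and removing `y` from `ω : N` adjoins at most `t` to `ω : (ω : N)`.
theorem colon_colon_sup_span_singleton_le (hω : ω ⩿ ω / coeSubmodule K (maximalIdeal R))
    (hN : ω / (ω / N) ≤ N) (ht : ∀ a ∈ maximalIdeal R, a • t ∈ N) :
    ω / (ω / (N ⊔ Submodule.span R {t})) ≤ N ⊔ Submodule.span R {t} := by
  by_cases htN : t ∈ N
  · rwa [sup_eq_left.mpr ((Submodule.span_singleton_le_iff_mem t N).mpr htN)]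
  obtain ⟨y, hy, hyt⟩ : ∃ y ∈ ω / N, y * t ∉ ω := by
    by_contra! h
    exact htN (hN fun y hy ↦ mul_comm y t ▸ h y hy)
  have hle := colon_le_colon_sup_span_singleton_sup hω ht hy hyt
  have hay : ∀ a ∈ maximalIdeal R, a • y ∈ ω / (N ⊔ Submodule.span R {t}) := fun a ha ↦ by
    refine mem_colon_sup_span_singleton.mpr ⟨Submodule.smul_mem _ a hy, ?_⟩
    rw [smul_mul_assoc, ← mul_smul_comm]
    exact hy _ (ht a ha)
  have hty : t ∈ ω / (ω / (N ⊔ Submodule.span R {t})) :=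
    le_colon_colon (Submodule.mem_sup_right (Submodule.mem_span_singleton_self t))
  refine (colon_le_colon_sup_span_singleton_sup hω hay hty (mul_comm y t ▸ hyt)).trans ?_
  exact sup_le_sup_right ((colon_anti hle).trans hN) _

theorem colon_colon_sup_le (hω : ω ⩿ ω / coeSubmodule K (maximalIdeal R)) (hJ : J.FG)
    (hN : ω / (ω / N) ≤ N) (hJN : coeSubmodule K (maximalIdeal R) * J ≤ N) :
    ω / (ω / (N ⊔ J)) ≤ N ⊔ J := by
  induction J, hJ using Submodule.fg_induction generalizing N with
  | singleton t =>
    refine colon_colon_sup_span_singleton_le hω hN fun a ha ↦ hJN ?_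
    rw [Algebra.smul_def]
    exact Submodule.mul_mem_mul ⟨a, ha, rfl⟩ (Submodule.mem_span_singleton_self t)
  | sup J₁ J₂ _ _ ih₁ ih₂ =>
    rw [Submodule.mul_sup, sup_le_iff] at hJN
    rw [← sup_assoc]
    exact ih₂ (ih₁ hN hJN.1) (hJN.2.trans le_sup_left)

end ColonDuality

theorem exists_covBy_notMem {R M : Type*} [CommRing R] [IsLocalRing R] [AddCommGroup M] [Module R M]
    {N P : Submodule R M} (hNP : N ≤ P) (hP : ∀ a ∈ maximalIdeal R, ∀ p ∈ P, a • p ∈ N)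
    {s : M} (hsP : s ∈ P) (hsN : s ∉ N) : ∃ W, N ≤ W ∧ W ⋖ P ∧ s ∉ W := by
  obtain ⟨W, hNW, ⟨hWP, hsW⟩, hmax⟩ := zorn_le_nonempty₀ {W | W ≤ P ∧ s ∉ W}
    (fun c hc hchain V hV ↦ ⟨sSup c, ⟨sSup_le fun V hV ↦ (hc hV).1, fun hs ↦ by
      obtain ⟨V, hVc, hsV⟩ := (Submodule.mem_sSup_of_directed ⟨V, hV⟩ hchain.directedOn).mp hs
      exact (hc hVc).2 hsV⟩, fun V hV ↦ le_sSup hV⟩) N ⟨hNP, hsN⟩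
  refine ⟨W, hNW, ⟨lt_of_le_of_ne hWP fun h ↦ hsW (h ▸ hsP), fun V hWV hVP ↦ hVP.not_ge ?_⟩, hsW⟩
  have hsV : s ∈ V := by
    by_contra hsV
    exact hWV.not_ge (hmax ⟨hVP.le, hsV⟩ hWV.le)
  intro p hp
  by_cases hpW : p ∈ W
  · exact hWV.le hpW
  have hs : s ∈ W ⊔ Submodule.span R {p} := by
    by_contra hs
    have hle := hmax ⟨sup_le hWP ((Submodule.span_singleton_le_iff_mem p P).mpr hp), hs⟩ le_sup_left
    exact hpW (hle (Submodule.mem_sup_right (Submodule.mem_span_singleton_self p)))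
  obtain ⟨w, hw, z, hz, rfl⟩ := Submodule.mem_sup.mp hs
  obtain ⟨r, rfl⟩ := Submodule.mem_span_singleton.mp hz
  have hr : IsUnit r := by
    by_contra hr
    exact hsW (add_mem hw (hNW (hP r ((mem_maximalIdeal r).mpr hr) p hp)))
  rwa [V.add_mem_iff_right (hWV.le hw), V.smul_mem_iff_of_isUnit hr] at hsV

section StableMaximalIdeal

variable {R K : Type*} [CommRing R] [Field K] [Algebra R K] {S : Subalgebra R K} {x : K}

theorem colon_subalgebra_eq_smul [IsNoetherianRing R] [IsLocalRing S] [Module.Finite R S]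
    {W : Submodule R K} (hx : x ≠ 0) (hdual : IsDualizing (1 : Submodule S K))
    (hWS : W ≤ S.toSubmodule) (hSW : x • S.toSubmodule ≤ W) {d : K}
    (hd : d ∈ (1 : Submodule S K) / coeSubmodule K (maximalIdeal S)) (hxd : x * d ∉ W) :
    W / S.toSubmodule = x • S.toSubmodule := by
  have colon_le : W / S.toSubmodule ≤ W :=
    (colon_anti (Submodule.one_le.mpr S.one_mem)).trans_eq colon_one
  have subalgebra_mul_colon_le : S.toSubmodule * (W / S.toSubmodule) ≤ W / S.toSubmodule := by
    rw [mul_comm, ← Submodule.le_div_iff_mul_le, ← colon_mul, subalgebra_mul_subalgebra]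
  obtain ⟨M, hM⟩ :=
    exists_restrictScalars_eq (subalgebra_mul_smul_le (c := x⁻¹) subalgebra_mul_colon_le)
  have one_le : 1 ≤ M := by
    have hone : 1 ∈ M.restrictScalars R := by
      rw [hM, mem_smul_iff_inv_mul_mem (inv_ne_zero hx), inv_inv, mul_one]
      exact fun s hs ↦ hSW (Submodule.smul_mem_pointwise_smul s x _ hs)
    exact Submodule.one_le.mpr hone
  rcases one_le.eq_or_lt with rfl | hlt
  · rw [← smul_inv_smul₀ hx (W / S.toSubmodule), ← hM]
    exact congrArg (x • ·) (by ext; simp)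
  · have hMfg : M.FG := Submodule.FG.of_restrictScalars (R := R)
      (hM ▸ fg_smul (fg_of_le_subalgebra (colon_le.trans hWS)))
    refine absurd (colon_le ?_) hxd
    have hdM : d ∈ M.restrictScalars R := hdual.colon_maximalIdeal_le hlt hMfg hd
    rwa [hM, mem_smul_iff_inv_mul_mem (inv_ne_zero hx), inv_inv] at hdM

variable [IsLocalRing R]

theorem maximalIdeal_mul_eq_iff (hx : x ≠ 0)
    (hm : coeSubmodule K (maximalIdeal R) = x • S.toSubmodule) {W : Submodule R K} (hW : 1 ≤ W) :
    coeSubmodule K (maximalIdeal R) = coeSubmodule K (maximalIdeal R) * W ↔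
      W ≤ S.toSubmodule := by
  rw [hm, smul_mul_eq_smul_mul, (MulAction.injective₀ hx).eq_iff]
  constructor
  · intro h
    exact h ▸ le_subalgebra_mul
  · intro h
    exact (le_mul_of_one_le_right' hW).antisymm
      ((mul_le_mul_right h _).trans_eq subalgebra_mul_subalgebra)

theorem mul_mem_of_mem_one_colon [FaithfulSMul R K] [IsLocalRing S]
    (hm : coeSubmodule K (maximalIdeal R) = x • S.toSubmodule) {d : K}
    (hd : d ∈ (1 : Submodule S K) / coeSubmodule K (maximalIdeal S)) : x * d ∈ S := by
  have smul_mem {s : K} (hs : s ∈ S) : x * s ∈ coeSubmodule K (maximalIdeal R) :=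
    hm ▸ Submodule.smul_mem_pointwise_smul s x S.toSubmodule hs
  obtain ⟨r, -, rfl⟩ : ∃ r ∈ maximalIdeal R, algebraMap R K r = x := by
    simpa using smul_mem S.one_mem
  have hrS : algebraMap R S r ∈ maximalIdeal S := by
    rw [mem_maximalIdeal]
    intro hu
    obtain ⟨s, hs⟩ := hu.exists_right_inv
    have hrs : algebraMap R K r * s = 1 := congrArg Subtype.val hs
    have one_mem : algebraMap R K 1 ∈ coeSubmodule K (maximalIdeal R) := by
      rw [map_one, ← hrs]
      exact smul_mem s.2
    exact Ideal.one_notMem _ ((algebraMap_mem_coeSubmodule K).mp one_mem)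
  obtain ⟨s, hs⟩ := Submodule.mem_one.mp (mem_colon_coeSubmodule.mp hd _ hrS)
  rw [algebraMap_smul, Algebra.smul_def] at hs
  exact hs ▸ s.2

theorem exists_mem_one_colon_mul_notMem_one [FaithfulSMul R K] [IsLocalRing S] [IsNoetherianRing S]
    [Ring.KrullDimLE 1 S] (hS : ¬IsField S) (hSR : S.toSubmodule ≠ 1) (hx : x ≠ 0)
    (hm : coeSubmodule K (maximalIdeal R) = x • S.toSubmodule) :
    ∃ d ∈ (1 : Submodule S K) / coeSubmodule K (maximalIdeal S), x * d ∉ (1 : Submodule R K) := by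
  by_contra! h
  obtain ⟨σ, hσ, hσS⟩ := SetLike.not_le_iff_exists.mp (not_one_colon_maximalIdeal_le (K := K) hS)
  obtain ⟨r, hr⟩ := Submodule.mem_one.mp (h σ hσ)
  have hru : IsUnit r := by
    by_contra hru
    have := (algebraMap_mem_coeSubmodule K).mpr ((mem_maximalIdeal r).mpr hru)
    rw [hr, hm, mul_mem_smul_iff hx] at this
    exact hσS (Submodule.mem_one.mpr ⟨⟨σ, this⟩, rfl⟩)
  have hinv : x⁻¹ ∈ (1 : Submodule S K) / coeSubmodule K (maximalIdeal S) := by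
    rw [← Submodule.smul_mem_iff_of_isUnit _ (hru.map (algebraMap R S)), algebraMap_smul,
      Algebra.smul_def, hr, mul_comm, inv_mul_cancel_left₀ hx]
    exact hσ
  refine hSR (le_antisymm (fun s hs ↦ ?_) (Submodule.one_le.mpr S.one_mem))
  have hs' := h _ (Submodule.smul_mem _ (⟨s, hs⟩ : S) hinv)
  rwa [Algebra.smul_def, mul_comm, mul_assoc, inv_mul_cancel₀ hx, mul_one] at hs'

variable [IsNoetherianRing R]

theorem finite_of_maximalIdeal_eq_smul (hx : x ≠ 0)
    (hm : coeSubmodule K (maximalIdeal R) = x • S.toSubmodule) : Module.Finite R S := by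
  have hfg : S.toSubmodule.FG := by
    rw [← inv_smul_smul₀ hx S.toSubmodule, ← hm]
    exact fg_smul ((IsNoetherian.noetherian _).map _)
  exact Module.Finite.of_fg hfg

theorem exists_covBy_colon_eq [FaithfulSMul R K] [IsLocalRing S] [Module.Finite R S]
    [Ring.KrullDimLE 1 S] (hS : ¬IsField S) (hSR : S.toSubmodule ≠ 1) (hx : x ≠ 0)
    (hm : coeSubmodule K (maximalIdeal R) = x • S.toSubmodule)
    (hdual : IsDualizing (1 : Submodule S K)) :
    ∃ W : Submodule R K, 1 ≤ W ∧ W ⋖ S.toSubmodule ∧ W / S.toSubmodule = x • S.toSubmodule := by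
  have : IsNoetherianRing S := IsNoetherianRing.of_finite R S
  obtain ⟨d, hd, hxd⟩ := exists_mem_one_colon_mul_notMem_one hS hSR hx hm
  have smul_le_one : x • S.toSubmodule ≤ 1 := hm ▸ coeSubmodule_le_one
  have maximalIdeal_smul_mem : ∀ a ∈ maximalIdeal R, ∀ s ∈ S.toSubmodule,
      a • s ∈ (1 : Submodule R K) := by
    intro a ha s hs
    rw [Algebra.smul_def]
    refine smul_le_one ?_
    rw [← subalgebra_mul_subalgebra, ← smul_mul_eq_smul_mul, ← hm]
    exact Submodule.mul_mem_mul ⟨a, ha, rfl⟩ hs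
  obtain ⟨W, hW, hcov, hdW⟩ := exists_covBy_notMem (Submodule.one_le.mpr S.one_mem)
    maximalIdeal_smul_mem (mul_mem_of_mem_one_colon hm hd) hxd
  exact ⟨W, hW, hcov,
    colon_subalgebra_eq_smul hx hdual hcov.le (smul_le_one.trans hW) hd hdW⟩

theorem isDualizing_of_covBy [Module.Finite R S] {W : Submodule R K} (hx : x ≠ 0)
    (hm : coeSubmodule K (maximalIdeal R) = x • S.toSubmodule) (hcov : W ⋖ S.toSubmodule)
    (hcolon : W / S.toSubmodule = x • S.toSubmodule) (hdual : IsDualizing (1 : Submodule S K)) :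
    IsDualizing W := by
  have hW : W ⩿ W / coeSubmodule K (maximalIdeal R) := by
    rw [hm, colon_smul hx, hcolon, inv_smul_smul₀ hx]
    exact hcov.wcovBy
  intro J hJ hJ0
  have hmul : S.toSubmodule * (coeSubmodule K (maximalIdeal R) * J) ≤
      coeSubmodule K (maximalIdeal R) * J := by
    rw [hm, smul_mul_eq_smul_mul]
    refine subalgebra_mul_smul_le ?_
    rw [← mul_assoc, subalgebra_mul_subalgebra]
  have hle : coeSubmodule K (maximalIdeal R) * J ≤ J :=
    mul_le_of_le_one_left' coeSubmodule_le_one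
  rw [← sup_eq_right.mpr hle]
  refine colon_colon_sup_le hW hJ ?_ le_rfl
  rw [colon_colon_eq_of_colon_subalgebra hx hcolon hmul]
  refine isDualizing_one_iff.mp hdual _ (((IsNoetherian.noetherian _).map _).mul hJ) ?_ hmul
  refine mul_ne_zero (fun h ↦ hx ?_) hJ0
  simpa [hm ▸ h] using Submodule.smul_mem_pointwise_smul 1 x S.toSubmodule S.one_mem

theorem exists_isDualizing_iff [FaithfulSMul R K] [IsLocalRing S] [Module.Finite R S]
    [Ring.KrullDimLE 1 S] (hS : ¬IsField S) (hx : x ≠ 0)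
    (hm : coeSubmodule K (maximalIdeal R) = x • S.toSubmodule) :
    (∃ W : Submodule R K, IsDualizing W ∧ 1 ≤ W ∧ W ≤ S.toSubmodule) ↔
      IsDualizing (1 : Submodule S K) := by
  constructor
  · rintro ⟨W, hW, hone, hWS⟩
    obtain ⟨c, hc, hcolon⟩ : ∃ c : K, c ≠ 0 ∧ W / S.toSubmodule = c • S.toSubmodule := by
      rcases hWS.eq_or_lt with rfl | hlt
      · exact ⟨1, one_ne_zero, by rw [subalgebra_colon_self, one_smul]⟩
      · refine ⟨x, hx, le_antisymm (hm ▸ hW.colon_le_maximalIdeal hlt) ?_⟩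
        rw [Submodule.le_div_iff_mul_le, smul_mul_eq_smul_mul, subalgebra_mul_subalgebra, ← hm]
        exact coeSubmodule_le_one.trans hone
    refine isDualizing_one_iff.mpr fun J hJ hJ0 hSJ ↦ ?_
    rw [← colon_colon_eq_of_colon_subalgebra hc hcolon hSJ]
    exact hW J hJ hJ0
  · intro hdual
    by_cases hSR : S.toSubmodule = 1
    · refine ⟨S.toSubmodule, fun J hJ hJ0 ↦ ?_, hSR.ge, le_rfl⟩
      exact isDualizing_one_iff.mp hdual J hJ hJ0 (by rw [hSR, one_mul])
    · obtain ⟨W, hW, hcov, hcolon⟩ := exists_covBy_colon_eq hS hSR hx hm hdual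
      exact ⟨W, isDualizing_of_covBy hx hm hcov hcolon hdual, hW, hcov.le⟩

theorem isAlmostGorenstein_iff_exists_isDualizing [IsDomain R] [IsFractionRing R K]
    [Module.Finite R S] (hx : x ≠ 0)
    (hm : coeSubmodule K (maximalIdeal R) = x • S.toSubmodule) :
    IsAlmostGorenstein R K ↔
      ∃ W : Submodule R K, IsDualizing W ∧ 1 ≤ W ∧ W ≤ S.toSubmodule := by
  have eq_mul_iff {ω : FractionalIdeal R⁰ K} :
      (maximalIdeal R : FractionalIdeal R⁰ K) = maximalIdeal R * ω ↔
        coeSubmodule K (maximalIdeal R) = coeSubmodule K (maximalIdeal R) * ω := by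
    rw [← FractionalIdeal.coeToSubmodule_inj, FractionalIdeal.coe_mul,
      FractionalIdeal.coe_coeIdeal]
  constructor
  · rintro ⟨ω, hω, hone, -, hmul⟩
    have one_le : (1 : Submodule R K) ≤ ω := by
      rwa [← FractionalIdeal.coe_one (S := R⁰), FractionalIdeal.coe_le_coe]
    exact ⟨ω, (isCanonicalIdeal_iff.mp hω).2, one_le,
      (maximalIdeal_mul_eq_iff hx hm one_le).mp (eq_mul_iff.mp hmul)⟩
  · rintro ⟨W, hW, hone, hWS⟩
    let ω : FractionalIdeal R⁰ K :=
      ⟨W, FractionalIdeal.isFractional_of_fg (fg_of_le_subalgebra hWS)⟩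
    have one_le : 1 ≤ ω := by
      rwa [← FractionalIdeal.coe_le_coe, FractionalIdeal.coe_one]
    exact ⟨ω, isCanonicalIdeal_iff.mpr ⟨(one_pos.trans_le one_le).ne', hW⟩, one_le,
      hWS.trans subalgebra_le_integralClosure,
      eq_mul_iff.mpr ((maximalIdeal_mul_eq_iff hx hm hone).mpr hWS)⟩

end StableMaximalIdeal

theorem proposition6p3_general (R : Type*) [CommRing R] [IsDomain R] [IsLocalRing R]
    [IsNoetherianRing R] (hdim : ringKrullDim R = 1) (K : Type*) [Field K] [Algebra R K]
    [IsFractionRing R K] [IsDiscreteValuationRing (integralClosure R K)]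
    (hstable : IsStableMaximalIdeal R K) :
    IsAlmostGorenstein R K ↔ IsGorensteinLocalRing (blowUp R K (maximalIdeal R)) := by
  have hR : ¬IsField R := (ringKrullDim_eq_one_iff_of_isLocalRing_isDomain.mp hdim).1
  have : Ring.KrullDimLE 1 R := Ring.krullDimLE_iff.mpr hdim.le
  obtain ⟨x, hx, hm⟩ := exists_maximalIdeal_eq_smul_blowUp hR hstable
  have : Module.Finite R (blowUp R K (maximalIdeal R)) := finite_of_maximalIdeal_eq_smul hx hm
  have : IsNoetherianRing (blowUp R K (maximalIdeal R)) := IsNoetherianRing.of_finite R _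
  have : Ring.KrullDimLE 1 (blowUp R K (maximalIdeal R)) := krullDimLE_one_of_finite
  have : IsLocalRing (blowUp R K (maximalIdeal R)) := isLocalRing_of_finite
  have hblowUp : ¬IsField (blowUp R K (maximalIdeal R)) :=
    mt (isField_of_isIntegral_of_isField (FaithfulSMul.algebraMap_injective R _)) hR
  rw [isAlmostGorenstein_iff_exists_isDualizing hx hm, exists_isDualizing_iff hblowUp hx hm,
    isGorensteinLocalRing_iff_isDualizing_one hblowUp (K := K)]

theorem proposition6p3 (R : Type*) [CommRing R] [IsDomain R] [IsLocalRing R] [IsNoetherianRing R]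
    (hdim : ringKrullDim R = 1) [Infinite (ResidueField R)]
    (K : Type*) [Field K] [Algebra R K] [IsFractionRing R K]
    [Module.Finite R (integralClosure R K)] [IsDiscreteValuationRing (integralClosure R K)]
    (hres : Function.Surjective (algebraMap R (ResidueField (integralClosure R K))))
    (hstable : IsStableMaximalIdeal R K) :
    IsAlmostGorenstein R K ↔ IsGorensteinLocalRing (blowUp R K (maximalIdeal R)) :=
  proposition6p3_general R hdim K hstable
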